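/- Let $\mathbb{H}$ be a separable real Hilbert space, let $d,n\ge1$ and $L_1,\dots,L_d\ge1$ be integers, and let $D_j\subset\mathbb{R}^{L_j}$ $(1\le j\le d)$ be compact sets of positive Lebesgue measure $|D_j|$; put $D=\prod_{j=1}^dD_j$. Let $h_j>0$ and let $K_j:[0,\infty)\to[0,\infty)$ be continuous, positive on $[0,1)$ and zero on $[1,\infty)$. Let a dataset $(\tilde\xi^i,\tilde Y^i)$, $1\le i\le n$, be given, with $\tilde\xi^i=(\tilde\xi^i_1,\dots,\tilde\xi^i_d)\in\prod_j\mathbb{R}^{L_j}$ and $\tilde Y^i\in\mathbb{H}$, such that $\tilde\xi^i\in D$ for at least one $i$. Write $I_i=1$ if $\tilde\xi^i\in D$ and $I_i=0$ otherwise, $N=\sum_{i=1}^nI_i$, and for $x_j,u_j\in\mathbb{R}^{L_j}$ $$K_{h_j}(x_j,u_j)=\frac{h_j^{-L_j}K_j(\|x_j-u_j\|/h_j)}{\int_{D_j}h_j^{-L_j}K_j(\|t_j-u_j\|/h_j)\,dt_j}$$ whenever the denominator is nonzero, and $K_{h_j}(x_j,u_j)=|D_j|^{-1}$ otherwise. Put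 $$\hat p^D(x)=\frac1N\sum_{i=1}^nI_i\prod_{j=1}^dK_{h_j}(x_j,\tilde\xi^i_j),\quad \hat p^D_j(x_j)=\frac1N\sum_{i=1}^nI_iK_{h_j}(x_j,\tilde\xi^i_j),\quad \hat p^D_{jk}(x_j,x_k)=\frac1N\sum_{i=1}^nI_iK_{h_j}(x_j,\tilde\xi^i_j)K_{h_k}(x_k,\tilde\xi^i_k),$$ $$\hat f_0=\frac1N\sum_{i=1}^nI_i\tilde Y^i,\qquad \hat m_j(x_j)=\frac1{N\hat p^D_j(x_j)}\sum_{i=1}^nI_iK_{h_j}(x_j,\tilde\xi^i_j)\tilde Y^i,$$ and let $\hat P^D$ be the measure on $D$ with density $\hat p^D$ with respect to Lebesgue measure. A tuple of measurable maps $g_j:D_j\to\mathbb{H}$ $(1\le j\le d)$ is said to satisfy the constraints if, for every $j$, $\int_{D_j}\|g_j\|^2\hat p^D_j\,dx_j<\infty$ and $\int_{D_j}\hat p^D_j g_j\,dx_j=0$. Let $(\hat f_j)_{j=1}^d$ be an SBF estimator, that is, a tuple satisfying the constraints and $$\hat f_j(x_j)=\hat m_j(x_j)-\hat f_0-\sum_{k\ne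 j}\int_{D_k}\frac{\hat p^D_{jk}(x_j,x_k)}{\hat p^D_j(x_j)}\hat f_k(x_k)\,dx_k,\qquad x_j\in D_j,\ 1\le j\le d.$$ Let $(\hat f^{[0]}_j)_{j=1}^d$ be any tuple satisfying the constraints and, for $r\ge1$, define the SBF iterates successively for $j=1,\dots,d$ by $$\hat f^{[r]}_j(x_j)=\hat m_j(x_j)-\hat f_0-\sum_{k<j}\int_{D_k}\frac{\hat p^D_{jk}(x_j,x_k)}{\hat p^D_j(x_j)}\hat f^{[r]}_k(x_k)\,dx_k-\sum_{k>j}\int_{D_k}\frac{\hat p^D_{jk}(x_j,x_k)}{\hat p^D_j(x_j)}\hat f^{[r-1]}_k(x_k)\,dx_k .$$ Put $\hat f(x)=\hat f_0+\sum_{j}\hat f_j(x_j)$ and $\hat f^{[r]}(x)=\hat f_0+\sum_j\hat f^{[r]}_j(x_j)$ for $x=(x_1,\dots,x_d)\in D$. Assume condition (A): for every $1\le j\le d$ and every $x_j\in D_j$ there is an $i$ with $\tilde\xi^i\in D$ and $\|\tilde\xi^i_j-x_j\|<h_j$. Then: (i) there are constants $\tilde c>0$ and $\tilde\varrho\in(0,1)$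 such that $\int_D\|\hat f^{[r]}(x)-\hat f(x)\|^2\,d\hat P^D(x)\le\tilde c\,\tilde\varrho^{\,r}$ for all $r\ge0$; (ii) $\lim_{r\to\infty}\|\hat f^{[r]}(x)-\hat f(x)\|=0$ for $\hat P^D$-almost every $x\in D$; (iii) for every $\varepsilon>0$ there is a Borel set $S(\varepsilon)\subset D$ with $\hat P^D(D\setminus S(\varepsilon))<\varepsilon$ and $\lim_{r\to\infty}\sup_{x\in S(\varepsilon)}\|\hat f^{[r]}(x)-\hat f(x)\|=0$. -/

import Mathlib

open MeasureTheory Filter Topology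
open scoped ENNReal

namespace SBF

/-- The raw ingredients of smooth backfitting for a given dataset: the estimation domains `D j`
in `ℝ^{L j}`, the baseline kernels `K j` (only their values on `[0, ∞)` matter), the bandwidths
`h j`, the observed predictors `ξ i = (ξ i 1, …, ξ i d)` and the observed responses `Y i`.
This is data only; nothing is assumed about it here. -/
structure Setup (d n : ℕ) (L : Fin d → ℕ) (H : Type*) where
  D : (j : Fin d) → Set (EuclideanSpace ℝ (Fin (L j)))
  K : Fin d → ℝ → ℝ
  h : Fin d → ℝ
  ξ : Fin n → (j : Fin d) → EuclideanSpace ℝ (Fin (L j))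
  Y : Fin n → H

/-- `K` is an admissible baseline kernel on `[0, ∞)`: continuous, positive on `[0, 1)` and zero
on `[1, ∞)`. -/
def IsBaselineKernel (K : ℝ → ℝ) : Prop :=
  ContinuousOn K (Set.Ici 0) ∧ (∀ t, 0 ≤ t → t < 1 → 0 < K t) ∧ ∀ t, 1 ≤ t → K t = 0

noncomputable section

namespace Setup

variable {d n : ℕ} {L : Fin d → ℕ} {H : Type*} (S : Setup d n L H)

/-- The product domain `D = ∏ D j`. -/
def domain : Set ((j : Fin d) → EuclideanSpace ℝ (Fin (L j))) :=
  Set.univ.pi S.D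

/-- The indicator `I(ξ i ∈ D)`. -/
def ind (i : Fin n) : ℝ :=
  S.domain.indicator (fun _ => (1 : ℝ)) (S.ξ i)

/-- The rescaled baseline kernel `h_j^{-L_j} K_j(‖x - u‖ / h_j)`. -/
def rawKernel (j : Fin d) (x u : EuclideanSpace ℝ (Fin (L j))) : ℝ :=
  (S.h j ^ L j)⁻¹ * S.K j (‖x - u‖ / S.h j)

/-- The normalized kernel `K_{h_j}(x, u)`, equal to `1 / |D_j|` where the normalizing integral
vanishes. -/
def kernel (j : Fin d) (x u : EuclideanSpace ℝ (Fin (L j))) : ℝ :=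
  if ∫ t in S.D j, S.rawKernel j t u = 0 then (volume.real (S.D j))⁻¹
  else S.rawKernel j x u / ∫ t in S.D j, S.rawKernel j t u

/-- `p̂_0^D`, the proportion of observations in `D`. -/
def p0Hat : ℝ :=
  (n : ℝ)⁻¹ * ∑ i, S.ind i

/-- The joint density estimator `p̂^D`. -/
def pHat (x : (j : Fin d) → EuclideanSpace ℝ (Fin (L j))) : ℝ :=
  (S.p0Hat * n)⁻¹ * ∑ i, (∏ j, S.kernel j (x j) (S.ξ i j)) * S.ind i

/-- The marginal density estimator `p̂_j^D`. -/
def pHat1 (j : Fin d) (x : EuclideanSpace ℝ (Fin (L j))) : ℝ :=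
  (S.p0Hat * n)⁻¹ * ∑ i, S.kernel j x (S.ξ i j) * S.ind i

/-- The two-dimensional marginal density estimator `p̂_{jk}^D` (used for `j ≠ k`). -/
def pHat2 (j k : Fin d) (x : EuclideanSpace ℝ (Fin (L j)))
    (y : EuclideanSpace ℝ (Fin (L k))) : ℝ :=
  (S.p0Hat * n)⁻¹ * ∑ i, S.kernel j x (S.ξ i j) * S.kernel k y (S.ξ i k) * S.ind i

/-- The measure `P̂^D`, with density `p̂^D` with respect to Lebesgue measure on `D`. -/
def measureHat : Measure ((j : Fin d) → EuclideanSpace ℝ (Fin (L j))) :=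
  (volume.restrict S.domain).withDensity fun x => ENNReal.ofReal (S.pHat x)

/-- Each point of each `D j` is within distance `< h j` of the `j`-th component of an observation
lying in `D`. -/
def ConditionA : Prop :=
  ∀ j, ∀ x ∈ S.D j, ∃ i, S.ξ i ∈ S.domain ∧ S.ξ i j ∈ Metric.ball x (S.h j)

variable [NormedAddCommGroup H] [InnerProductSpace ℝ H]

/-- The estimator `f̂_0` of the constant. -/
def f0Hat : H :=
  (S.p0Hat * n)⁻¹ • ∑ i, S.ind i • S.Y i

/-- The marginal regression estimator `m̂_j`. -/
def mHat (j : Fin d) (x : EuclideanSpace ℝ (Fin (L j))) : H :=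
  (S.pHat1 j x * S.p0Hat * n)⁻¹ • ∑ i, (S.kernel j x (S.ξ i j) * S.ind i) • S.Y i

/-- `∫_{D_k} g(y) ⊙ (p̂_{jk}(x, y) / p̂_j(x)) dy`. -/
def condInt (j k : Fin d) (g : EuclideanSpace ℝ (Fin (L k)) → H)
    (x : EuclideanSpace ℝ (Fin (L j))) : H :=
  ∫ y in S.D k, (S.pHat2 j k x y / S.pHat1 j x) • g y

/-- The centering and square-integrability constraints on a tuple of component maps `g j` on
`D j`; values off `D j` play no role. -/
def Constraints (g : (j : Fin d) → EuclideanSpace ℝ (Fin (L j)) → H) : Prop :=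
  ∀ j, AEStronglyMeasurable (g j) (volume.restrict (S.D j)) ∧
    IntegrableOn (fun x => ‖g j x‖ ^ 2 * S.pHat1 j x) (S.D j) ∧
    ∫ x in S.D j, S.pHat1 j x • g j x = 0

/-- `g` is an SBF estimator: it solves the estimated system of Bochner integral equations at every
point of the domains and satisfies the constraints. -/
def IsEstimator (g : (j : Fin d) → EuclideanSpace ℝ (Fin (L j)) → H) : Prop :=
  (∀ j, ∀ x ∈ S.D j, g j x = S.mHat j x - S.f0Hat -
    ∑ k ∈ Finset.univ.filter (fun k => k ≠ j), S.condInt j k (g k) x) ∧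
  S.Constraints g

/-- One sweep of the SBF algorithm started from `g`: the components are updated one after the
other, the `j`-th one from the already updated components `k < j` and the old ones `k > j`. -/
def sweep (g : (j : Fin d) → EuclideanSpace ℝ (Fin (L j)) → H) (j : Fin d) :
    EuclideanSpace ℝ (Fin (L j)) → H := fun x =>
  S.mHat j x - S.f0Hat -
    (∑ k : Fin d, if _hk : k < j then S.condInt j k (sweep g k) x else 0) -
    ∑ k ∈ Finset.univ.filter (fun k => j < k), S.condInt j k (g k) x
termination_by j

/-- The iterate `(f̂_j^{[r]})_j` of the SBF algorithm with initial estimator `g`. -/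
def iter (g : (j : Fin d) → EuclideanSpace ℝ (Fin (L j)) → H) :
    ℕ → (j : Fin d) → EuclideanSpace ℝ (Fin (L j)) → H
  | 0 => g
  | r + 1 => S.sweep (iter g r)

/-- The defining recursion of the SBF algorithm. -/
theorem iter_succ (g : (j : Fin d) → EuclideanSpace ℝ (Fin (L j)) → H) (r : ℕ) (j : Fin d)
    (x : EuclideanSpace ℝ (Fin (L j))) :
    S.iter g (r + 1) j x = S.mHat j x - S.f0Hat -
      (∑ k ∈ Finset.univ.filter (fun k => k < j), S.condInt j k (S.iter g (r + 1) k) x) -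
      ∑ k ∈ Finset.univ.filter (fun k => j < k), S.condInt j k (S.iter g r k) x := by
  simp only [iter]
  rw [sweep]
  simp only [dite_eq_ite, Finset.sum_filter]

/-- The regression map `f̂_0 ⊕ ⨁_j g_j(x_j)`. -/
def total (g : (j : Fin d) → EuclideanSpace ℝ (Fin (L j)) → H)
    (x : (j : Fin d) → EuclideanSpace ℝ (Fin (L j))) : H :=
  S.f0Hat + ∑ j, g j (x j)

end Setup

end

end SBF

/-! The kernel of the conditional integral operators has finite rank: $\hat p^D_{jk}(x_j,x_k)/\hat
p^D_j(x_j)$ is a sum over $i$ of a normalized weight $q_{j,i}(x_j)$ (`normWeight`) times a kernel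
weight of $x_k$. Subtracting the fixed-point equation for $\hat f$ from one sweep cancels $\hat
m_j-\hat f_0$, so after the first sweep the $j$-th error is $\sum_i q_{j,i}w_{j,i}$ with
coefficients $w_{j,i}\in\mathbb{H}$ (`sweep_sub`), and these obey a finite block Gauss–Seidel
recursion (`sweepCoeff_sweep`).

$\hat P^D$ is a mixture over observations of product measures, so the components are conditionally
independent given the label. The Gram matrix of the $q_{j,i}$ in $L^2(\hat P^D)$ is therefore
expressed by the same matrices that drive the recursion, and updating block $j$ is orthogonal
projection onto the complement of the span of the $q_{j,i}$. On the finite-dimensional span of all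
blocks, a vector whose norm survives every projection is orthogonal to every block, hence zero;
compactness of the sphere gives a factor $\varrho<1$ (`exists_gauss_seidel_contraction`).

In finite dimension the $L^2$ norm also controls values almost everywhere
(`exists_ae_abs_sum_le_norm_toLp`). So off one null set the error after $r+1$ sweeps is at most
$C\varrho^r$, uniformly in $x$, and all three claims follow. -/

/-! ### Successive projections and pointwise bounds in finite dimension -/

/-- The condition on `u` says that `u (s + 1)` is the projection of `u s` onto the orthogonal
complement of `F s`. Equality in the norm bound for the composite would force a vector orthogonal to
every `F s`, so the bound is strict on the unit sphere, where the maximum is attained. -/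
theorem exists_sequential_projection_contraction {E : Type*} [NormedAddCommGroup E]
    [InnerProductSpace ℝ E] [FiniteDimensional ℝ E] (d : ℕ) (F : ℕ → Submodule ℝ E)
    (hF : ∀ x : E, (∀ s < d, ∀ y ∈ F s, inner ℝ y x = 0) → x = 0) :
    ∃ ρ ∈ Set.Ioo (0 : ℝ) 1, ∀ u : ℕ → E,
      (∀ s < d, u (s + 1) - u s ∈ F s ∧ ∀ y ∈ F s, inner ℝ y (u (s + 1)) = 0) →
      ‖u d‖ ≤ ρ * ‖u 0‖ := by
  let Q : ℕ → E →L[ℝ] E := fun t =>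
    Nat.rec (ContinuousLinearMap.id ℝ E) (fun s T => (F s)ᗮ.starProjection.comp T) t
  have Q0 : ∀ x, Q 0 x = x := fun x => rfl
  have Qs : ∀ t x, Q (t + 1) x = (F t)ᗮ.starProjection (Q t x) := fun t x => rfl
  have hle : ∀ t x, ‖Q t x‖ ≤ ‖x‖ := by
    intro t x
    induction t with
    | zero => simp [Q0]
    | succ t ih =>
      rw [Qs]
      exact (Submodule.norm_starProjection_apply_le _ _).trans ih
  have heq : ∀ t x, ‖Q t x‖ = ‖x‖ → Q t x = x ∧ ∀ s < t, ∀ y ∈ F s, inner ℝ y x = 0 := by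
    intro t x
    induction t with
    | zero => simp [Q0]
    | succ t ih =>
      intro h
      rw [Qs] at h
      have h1 := Submodule.norm_starProjection_apply_le (F t)ᗮ (Q t x)
      have h2 := hle t x
      obtain ⟨h3, h4⟩ := ih (by linarith)
      rw [h3] at h
      have h5 : x ∈ (F t)ᗮ := by
        exact (Submodule.mem_iff_norm_starProjection _ _).2 h
      refine ⟨by rw [Qs, h3]; exact Submodule.starProjection_eq_self_iff.2 h5, fun s hs => ?_⟩
      rcases Nat.lt_succ_iff_lt_or_eq.1 hs with hs | rfl
      · exact h4 s hs
      · exact (Submodule.mem_orthogonal _ _).1 h5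
  have hu : ∀ u : ℕ → E,
      (∀ s < d, u (s + 1) - u s ∈ F s ∧ ∀ y ∈ F s, inner ℝ y (u (s + 1)) = 0) →
      ∀ t ≤ d, u t = Q t (u 0) := by
    intro u h t ht
    induction t with
    | zero => rfl
    | succ t ih =>
      rw [Qs, ← ih (by omega)]
      obtain ⟨h1, h2⟩ := h t (by omega)
      refine Eq.symm (Submodule.eq_starProjection_of_mem_of_inner_eq_zero
        ((Submodule.mem_orthogonal _ _).2 h2) fun w hw => ?_)
      rw [← neg_sub, inner_neg_left, Submodule.inner_right_of_mem_orthogonal h1 hw, neg_zero]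
  obtain ⟨ρ, hρ, hb⟩ : ∃ ρ ∈ Set.Ioo (0 : ℝ) 1, ∀ x, ‖Q d x‖ ≤ ρ * ‖x‖ := by
    have hlt : ∀ x, ‖x‖ = 1 → ‖Q d x‖ < 1 := by
      intro x hx
      refine lt_of_le_of_ne (hx ▸ hle d x) fun h => ?_
      have := hF x (heq d x (h.trans hx.symm)).2
      simp [this] at hx
    obtain ⟨ρ, hρ0, hρ1, hb⟩ : ∃ ρ : ℝ, 0 < ρ ∧ ρ < 1 ∧ ∀ x, ‖x‖ = 1 → ‖Q d x‖ ≤ ρ := by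
      rcases (Metric.sphere (0 : E) 1).eq_empty_or_nonempty with he | hne
      · refine ⟨1 / 2, by norm_num, by norm_num, fun x hx => ?_⟩
        have : x ∈ Metric.sphere (0 : E) 1 := by simpa using hx
        simp [he] at this
      · obtain ⟨y, hy, hm⟩ := (isCompact_sphere (0 : E) 1).exists_isMaxOn hne
          (f := fun x => ‖Q d x‖) (by fun_prop)
        have hy1 := hlt y (by simpa using hy)
        -- The maximum with `1 / 2` keeps the factor positive even if the composite vanishes.
        refine ⟨max ‖Q d y‖ (1 / 2), by simp, max_lt hy1 (by norm_num), fun x hx => ?_⟩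
        exact (hm (by simpa using hx)).trans (le_max_left _ _)
    refine ⟨ρ, ⟨hρ0, hρ1⟩, fun x => ?_⟩
    rcases eq_or_ne x 0 with rfl | hx
    · simp
    have hx' : 0 < ‖x‖ := norm_pos_iff.2 hx
    have := hb (‖x‖⁻¹ • x) (by rw [norm_smul, norm_inv, norm_norm, inv_mul_cancel₀ hx'.ne'])
    rw [map_smul, norm_smul, norm_inv, norm_norm, inv_mul_le_iff₀ hx'] at this
    linarith
  exact ⟨ρ, hρ, fun u h => (hu u h d le_rfl) ▸ hb (u 0)⟩

/-- A block Gauss--Seidel sweep contracts the seminorm of a Gram structure in which distinct blocks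
are conditionally independent given a finite label. -/
theorem exists_gauss_seidel_contraction {E : Type*} [NormedAddCommGroup E]
    [InnerProductSpace ℝ E] {d n : ℕ} (e : Fin d → Fin n → E) (G : Fin d → Fin n → Fin n → ℝ)
    (c : ℝ) (hdiag : ∀ j i l, inner ℝ (e j i) (e j l) = c * G j l i)
    (hoff : ∀ j k, k ≠ j → ∀ i i', inner ℝ (e j i) (e k i') = c * ∑ l, G j l i * G k l i') :
    ∃ ρ ∈ Set.Ioo (0 : ℝ) 1, ∀ w w' : Fin d → Fin n → ℝ,
      (∀ j l, w' j l = -∑ k, ∑ i, G k l i *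
        (if k < j then w' k i else if j < k then w k i else 0)) →
      ‖∑ j, ∑ i, w' j i • e j i‖ ≤ ρ * ‖∑ j, ∑ i, w j i • e j i‖ := by
  classical
  let V : Submodule ℝ E := Submodule.span ℝ (Set.range fun p : Fin d × Fin n => e p.1 p.2)
  have heV : ∀ j i, e j i ∈ V := fun j i => Submodule.subset_span ⟨(j, i), rfl⟩
  have : FiniteDimensional ℝ V := FiniteDimensional.span_of_finite ℝ (Set.finite_range _)
  let b : Fin d → Fin n → V := fun j i => ⟨e j i, heV j i⟩
  let F : ℕ → Submodule ℝ V := fun s =>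
    if h : s < d then Submodule.span ℝ (Set.range (b ⟨s, h⟩)) else ⊥
  have hFs : ∀ j : Fin d, F j = Submodule.span ℝ (Set.range (b j)) := fun j => by
    simp only [F, j.2, dite_true]
  obtain ⟨ρ, hρ, hc⟩ := exists_sequential_projection_contraction d F (by
    intro x hx
    have hall : ∀ p : Fin d × Fin n, inner ℝ (e p.1 p.2) (x : E) = 0 := fun p =>
      hx p.1 p.1.2 (b p.1 p.2) (by rw [hFs]; exact Submodule.subset_span ⟨_, rfl⟩)
    have hperp : (x : E) ∈ Vᗮ := by
      rw [Submodule.mem_orthogonal]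
      intro y hy
      induction hy using Submodule.span_induction with
      | mem y h => obtain ⟨p, rfl⟩ := h; exact hall p
      | zero => simp
      | add y z _ _ h1 h2 => rw [inner_add_left, h1, h2, add_zero]
      | smul a y _ h => rw [inner_smul_left, h, mul_zero]
    have := (Submodule.mem_orthogonal _ _).1 hperp x x.2
    exact Subtype.ext (inner_self_eq_zero.1 this))
  refine ⟨ρ, hρ, fun w w' hw => ?_⟩
  -- State within the sweep: the blocks before `s` are updated, the others are old.
  let m : ℕ → Fin d → Fin n → ℝ := fun s k i => if (k : ℕ) < s then w' k i else w k i
  let u : ℕ → V := fun s => ∑ k, ∑ i, m s k i • b k i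
  have key := hc u (by
    intro s hs
    have hm : ∀ k i, m (s + 1) k i - m s k i =
        if k = ⟨s, hs⟩ then w' k i - w k i else 0 := by
      intro k i
      simp only [m, Fin.ext_iff]
      rcases lt_trichotomy (k : ℕ) s with h | h | h
      · simp [h, h.ne, Nat.lt_succ_of_lt h]
      · simp [h]
      · simp [h.ne', not_lt.2 h.le, show ¬ (k : ℕ) < s + 1 by omega]
    constructor
    · have : u (s + 1) - u s = ∑ i, (w' ⟨s, hs⟩ i - w ⟨s, hs⟩ i) • b ⟨s, hs⟩ i := by
        simp only [u, ← Finset.sum_sub_distrib, ← sub_smul, hm]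
        rw [Finset.sum_eq_single_of_mem ⟨s, hs⟩ (Finset.mem_univ _)]
        · simp
        · intro k _ hk
          simp [hk]
      rw [this, hFs ⟨s, hs⟩]
      exact Submodule.sum_mem _ fun i _ =>
        Submodule.smul_mem _ _ (Submodule.subset_span ⟨i, rfl⟩)
    · intro y hy
      rw [hFs ⟨s, hs⟩] at hy
      induction hy using Submodule.span_induction with
      | zero => simp
      | add y z _ _ h1 h2 => rw [inner_add_left, h1, h2, add_zero]
      | smul a y _ h => rw [inner_smul_left, h, mul_zero]
      | mem y h =>
        obtain ⟨i, rfl⟩ := h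
        -- By the Gram relations the inner product equals `c * ∑ l, G j l i * (w' j l + …)`, where
        -- the dots are the contribution of the other blocks; the recursion makes each bracket
        -- vanish.
        set j : Fin d := ⟨s, hs⟩ with hj
        have h1 : inner ℝ (b j i) (u (s + 1)) =
            ∑ k, ∑ i', m (s + 1) k i' * inner ℝ (e j i) (e k i') := by
          simp only [u, inner_sum, inner_smul_right]
          rfl
        rw [h1, Finset.sum_eq_add_sum_sdiff_singleton_of_mem (Finset.mem_univ j)]
        have h2 : ∑ k ∈ Finset.univ \ {j}, ∑ i', m (s + 1) k i' * inner ℝ (e j i) (e k i') =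
            c * ∑ l, G j l i * ∑ k, ∑ i', G k l i' *
              (if k < j then w' k i' else if j < k then w k i' else 0) := by
          have h3 : ∀ k ∈ Finset.univ \ {j},
              ∑ i', m (s + 1) k i' * inner ℝ (e j i) (e k i') =
              c * ∑ l, G j l i * ∑ i', G k l i' *
              (if k < j then w' k i' else if j < k then w k i' else 0) := by
            intro k hk
            have hkj : k ≠ j := by simpa using hk
            have h4 : ∀ i', m (s + 1) k i' =
                (if k < j then w' k i' else if j < k then w k i' else 0) := by
              intro i'
              simp only [m, Fin.lt_def, hj]
              have : (k : ℕ) ≠ s := fun h => hkj (Fin.ext h)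
              grind
            simp only [h4, hoff j k hkj, Finset.mul_sum]
            rw [Finset.sum_comm]
            refine Finset.sum_congr rfl fun l _ => Finset.sum_congr rfl fun i' _ => ?_
            ring
          rw [Finset.sum_congr rfl h3, ← Finset.mul_sum, Finset.sum_comm]
          congr 1
          refine Finset.sum_congr rfl fun l _ => ?_
          rw [← Finset.mul_sum]
          congr 1
          rw [eq_comm, Finset.sum_eq_add_sum_sdiff_singleton_of_mem (Finset.mem_univ j)]
          simp
        rw [h2]
        have h5 : ∀ i', m (s + 1) j i' = w' j i' := fun i' => by simp [m, hj]
        simp only [h5, hdiag]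
        rw [Finset.mul_sum, ← Finset.sum_add_distrib]
        refine Finset.sum_eq_zero fun l _ => ?_
        rw [hw j l]
        ring)
  have hend : ∀ s, ((u s : V) : E) = ∑ k, ∑ i, m s k i • e k i := by
    intro s
    simp [u, b]
  have h0 : ‖u 0‖ = ‖∑ j, ∑ i, w j i • e j i‖ := by
    rw [← Submodule.norm_coe, hend]; simp [m]
  have hd : ‖u d‖ = ‖∑ j, ∑ i, w' j i • e j i‖ := by
    rw [← Submodule.norm_coe, hend]; simp [m]
  rwa [h0, hd] at key

/-- Almost everywhere, the value of a linear
combination is controlled by its `L²` norm. -/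
theorem exists_ae_abs_sum_le_norm_toLp {X ι : Type*} [MeasurableSpace X] {μ : Measure X} [Fintype ι]
    (g : ι → X → ℝ) (hg : ∀ i, MemLp (g i) 2 μ) (hb : ∀ i x, |g i x| ≤ 1) :
    ∃ C : ℝ, 0 ≤ C ∧ ∀ᵐ x ∂μ, ∀ w : ι → ℝ,
      |∑ i, w i * g i x| ≤ C * ‖∑ i, w i • (hg i).toLp (g i)‖ := by
  classical
  let φ : (ι → ℝ) →ₗ[ℝ] Lp ℝ 2 μ := Fintype.linearCombination ℝ fun i => (hg i).toLp (g i)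
  have hφ : ∀ w, φ w = ∑ i, w i • (hg i).toLp (g i) := fun w => rfl
  -- The classes may be linearly dependent, so coefficients are not controlled by the norm. A linear
  -- section picks a representative that is, being continuous on a finite-dimensional range.
  obtain ⟨s, hs⟩ := φ.rangeRestrict.exists_rightInverse_of_surjective
    (LinearMap.range_eq_top.2 φ.surjective_rangeRestrict)
  let sc := LinearMap.toContinuousLinearMap s
  -- A finite basis of the kernel yields a single null set valid for all `w`.
  have hker : ∀ᵐ x ∂μ, ∀ w ∈ LinearMap.ker φ, ∑ i, w i * g i x = 0 := by
    let b := Module.finBasis ℝ (LinearMap.ker φ)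
    have h1 : ∀ᵐ x ∂μ, ∀ t, ∑ i, (b t : ι → ℝ) i * g i x = 0 := by
      rw [ae_all_iff]
      intro t
      have h2 : φ (b t) = 0 := (b t).2
      rw [hφ] at h2
      have h3 : (∑ i, (b t : ι → ℝ) i • (hg i).toLp (g i) : Lp ℝ 2 μ) =
          (memLp_finsetSum (Finset.univ : Finset ι)
            fun i _ => (hg i).const_smul ((b t : ι → ℝ) i)).toLp _ := by
        refine Lp.ext ?_
        refine (Lp.coeFn_finsetSum _ _).trans ?_
        refine EventuallyEq.trans ?_ (MemLp.coeFn_toLp _).symm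
        have h4 : ∀ᵐ x ∂μ, ∀ i, ((b t : ι → ℝ) i • (hg i).toLp (g i) : Lp ℝ 2 μ) x =
            (b t : ι → ℝ) i • g i x := by
          rw [ae_all_iff]
          intro i
          filter_upwards [Lp.coeFn_smul ((b t : ι → ℝ) i) ((hg i).toLp (g i)),
            (hg i).coeFn_toLp] with x hx hx'
          rw [hx, Pi.smul_apply, hx']
        filter_upwards [h4] with x hx
        simp [hx]
      rw [h3] at h2
      have h5 := (MemLp.coeFn_toLp _).symm.trans ((congrArg (fun F : Lp ℝ 2 μ => ⇑F) h2) ▸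
        (Lp.coeFn_zero ℝ 2 μ))
      filter_upwards [h5] with x hx
      simpa using hx
    filter_upwards [h1] with x hx w hw
    have h6 := b.sum_repr ⟨w, hw⟩
    have h7 : w = ∑ t, b.repr ⟨w, hw⟩ t • (b t : ι → ℝ) := by
      have := congrArg (Submodule.subtype _) h6
      rw [map_sum] at this
      simpa only [map_smul, Submodule.subtype_apply] using this.symm
    rw [h7]
    simp only [Finset.sum_apply, Pi.smul_apply, smul_eq_mul, Finset.sum_mul]
    rw [Finset.sum_comm]
    refine Finset.sum_eq_zero fun t _ => ?_
    simp only [mul_assoc, ← Finset.mul_sum, hx t, mul_zero]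
  refine ⟨Fintype.card ι * ‖sc‖, by positivity, ?_⟩
  filter_upwards [hker] with x hx w
  set w₁ := s (φ.rangeRestrict w) with hw₁
  have h1 : φ w₁ = φ w := by
    have := congrArg (fun T => ((T (φ.rangeRestrict w) : LinearMap.range φ) : Lp ℝ 2 μ)) hs
    simpa [hw₁] using this
  have h2 := hx (w - w₁) (by simp [h1])
  have h3 : ∑ i, w i * g i x = ∑ i, w₁ i * g i x := by
    simp only [Pi.sub_apply, sub_mul, Finset.sum_sub_distrib] at h2
    linarith
  rw [h3, ← hφ]
  have h4 : ‖w₁‖ ≤ ‖sc‖ * ‖φ w‖ := sc.le_opNorm (φ.rangeRestrict w)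
  calc |∑ i, w₁ i * g i x| ≤ ∑ i, |w₁ i * g i x| := Finset.abs_sum_le_sum_abs _ _
    _ ≤ ∑ _i : ι, ‖w₁‖ := by
        refine Finset.sum_le_sum fun i _ => ?_
        rw [abs_mul]
        have := norm_le_pi_norm w₁ i
        rw [Real.norm_eq_abs] at this
        exact (mul_le_of_le_one_right (abs_nonneg _) (hb i x)).trans this
    _ = Fintype.card ι * ‖w₁‖ := by simp
    _ ≤ _ := by rw [mul_assoc]; gcongr

theorem MeasureTheory.Measure.pi_withDensity_ofReal {ι : Type*} [Fintype ι] {α : ι → Type*}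
    [∀ i, MeasurableSpace (α i)] (ν : (i : ι) → Measure (α i)) [∀ i, SigmaFinite (ν i)]
    (f : (i : ι) → α i → ℝ) (hf : ∀ i, Integrable (f i) (ν i)) (h0 : ∀ i x, 0 ≤ f i x) :
    (Measure.pi ν).withDensity (fun x => ENNReal.ofReal (∏ i, f i (x i))) =
      Measure.pi fun i => (ν i).withDensity fun x => ENNReal.ofReal (f i x) := by
  have hfin : ∀ i, IsFiniteMeasure ((ν i).withDensity fun x => ENNReal.ofReal (f i x)) :=
    fun i => isFiniteMeasure_withDensity_ofReal (hf i).2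
  refine (Measure.pi_eq fun s hs => ?_).symm
  rw [withDensity_apply _ (MeasurableSet.univ_pi hs), Measure.restrict_pi_pi,
    ← ofReal_integral_eq_lintegral_ofReal
      (Integrable.fintype_prod_dep fun i => (hf i).restrict)
      (ae_of_all _ fun x => Finset.prod_nonneg fun i _ => h0 i _),
    integral_fintype_prod_eq_prod,
    ENNReal.ofReal_prod_of_nonneg fun i _ => integral_nonneg (h0 i)]
  refine Finset.prod_congr rfl fun i _ => ?_
  rw [withDensity_apply _ (hs i),
    ofReal_integral_eq_lintegral_ofReal (hf i).restrict (ae_of_all _ (h0 i))]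

/-! ### Kernel weights and their Gram matrix under the mixture measure -/

namespace SBF

theorem IsBaselineKernel.nonneg {K : ℝ → ℝ} (hK : IsBaselineKernel K) {t : ℝ} (ht : 0 ≤ t) :
    0 ≤ K t := by
  rcases lt_or_ge t 1 with h | h
  · exact (hK.2.1 t ht h).le
  · exact (hK.2.2 t h).ge

noncomputable section

namespace Setup

variable {d n : ℕ} {L : Fin d → ℕ} {H : Type*} (S : Setup d n L H)

theorem rawKernel_nonneg {j : Fin d} (hK : IsBaselineKernel (S.K j)) (hh : 0 < S.h j)
    (x u : EuclideanSpace ℝ (Fin (L j))) : 0 ≤ S.rawKernel j x u :=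
  mul_nonneg (by positivity) (hK.nonneg (by positivity))

theorem continuous_rawKernel {j : Fin d} (hK : IsBaselineKernel (S.K j)) (hh : 0 < S.h j)
    (u : EuclideanSpace ℝ (Fin (L j))) : Continuous fun x => S.rawKernel j x u := by
  refine continuous_const.mul (hK.1.comp_continuous (by fun_prop) fun x => ?_)
  exact Set.mem_Ici.2 (by positivity)

theorem kernel_nonneg {j : Fin d} (hK : IsBaselineKernel (S.K j)) (hh : 0 < S.h j)
    (x u : EuclideanSpace ℝ (Fin (L j))) : 0 ≤ S.kernel j x u := by
  unfold kernel
  split_ifs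
  · exact inv_nonneg.2 measureReal_nonneg
  · exact div_nonneg (S.rawKernel_nonneg hK hh _ _)
      (integral_nonneg fun t => S.rawKernel_nonneg hK hh _ _)

theorem continuous_kernel {j : Fin d} (hK : IsBaselineKernel (S.K j)) (hh : 0 < S.h j)
    (u : EuclideanSpace ℝ (Fin (L j))) : Continuous fun x => S.kernel j x u := by
  unfold kernel
  split_ifs
  · exact continuous_const
  · exact (S.continuous_rawKernel hK hh u).div_const _

theorem integrableOn_kernel {j : Fin d} (hD : IsCompact (S.D j)) (hK : IsBaselineKernel (S.K j))
    (hh : 0 < S.h j) (u : EuclideanSpace ℝ (Fin (L j))) :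
    IntegrableOn (fun x => S.kernel j x u) (S.D j) :=
  (S.continuous_kernel hK hh u).continuousOn.integrableOn_compact hD

theorem setIntegral_kernel {j : Fin d} (hD : IsCompact (S.D j)) (hpos : 0 < volume (S.D j))
    (u : EuclideanSpace ℝ (Fin (L j))) : ∫ x in S.D j, S.kernel j x u = 1 := by
  unfold kernel
  split_ifs with h
  · have : volume.real (S.D j) ≠ 0 := (ENNReal.toReal_pos hpos.ne' hD.measure_lt_top.ne).ne'
    simp [this]
  · rw [integral_div, div_self h]

theorem ind_eq_zero_or_one (i : Fin n) : S.ind i = 0 ∨ S.ind i = 1 := by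
  classical
  unfold ind
  rw [Set.indicator_apply]
  split_ifs <;> simp

theorem ind_nonneg (i : Fin n) : 0 ≤ S.ind i := by
  rcases S.ind_eq_zero_or_one i with h | h <;> simp [h]

theorem ind_mul_self (i : Fin n) : S.ind i * S.ind i = S.ind i := by
  rcases S.ind_eq_zero_or_one i with h | h <;> simp [h]

/-- The kernel weight `K_{h_j}(x, ξ i j) I(ξ i ∈ D)` of the `i`-th observation at `x`. -/
def weight (j : Fin d) (i : Fin n) (x : EuclideanSpace ℝ (Fin (L j))) : ℝ :=
  S.kernel j x (S.ξ i j) * S.ind i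

/-- The normalized kernel weight of the `i`-th observation at `x`. -/
def normWeight (j : Fin d) (i : Fin n) (x : EuclideanSpace ℝ (Fin (L j))) : ℝ :=
  S.weight j i x / ∑ l, S.weight j l x

/-- The integral of the `i`-th normalized weight against the `l`-th weight. -/
def transfer (j : Fin d) (l i : Fin n) : ℝ :=
  ∫ x in S.D j, S.weight j l x * S.normWeight j i x

/-- The law of the `j`-th component under the smoothed `l`-th observation. -/
def kernelLaw (j : Fin d) (l : Fin n) : Measure (EuclideanSpace ℝ (Fin (L j))) :=
  (volume.restrict (S.D j)).withDensity fun x => ENNReal.ofReal (S.kernel j x (S.ξ l j))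

theorem weight_nonneg {j : Fin d} (hK : IsBaselineKernel (S.K j)) (hh : 0 < S.h j) (i : Fin n)
    (x : EuclideanSpace ℝ (Fin (L j))) : 0 ≤ S.weight j i x :=
  mul_nonneg (S.kernel_nonneg hK hh _ _) (S.ind_nonneg i)

theorem continuous_weight {j : Fin d} (hK : IsBaselineKernel (S.K j)) (hh : 0 < S.h j)
    (i : Fin n) : Continuous (S.weight j i) :=
  (S.continuous_kernel hK hh _).mul_const _

theorem weight_le_sum {j : Fin d} (hK : IsBaselineKernel (S.K j)) (hh : 0 < S.h j) (i : Fin n)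
    (x : EuclideanSpace ℝ (Fin (L j))) : S.weight j i x ≤ ∑ l, S.weight j l x :=
  Finset.single_le_sum (f := fun l => S.weight j l x) (fun l _ => S.weight_nonneg hK hh l x)
    (Finset.mem_univ i)

theorem measurable_normWeight {j : Fin d} (hK : IsBaselineKernel (S.K j)) (hh : 0 < S.h j)
    (i : Fin n) : Measurable (S.normWeight j i) :=
  (S.continuous_weight hK hh i).measurable.div
    (Finset.measurable_fun_sum _ fun l _ => (S.continuous_weight hK hh l).measurable)

theorem abs_normWeight_le_one {j : Fin d} (hK : IsBaselineKernel (S.K j)) (hh : 0 < S.h j)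
    (i : Fin n) (x : EuclideanSpace ℝ (Fin (L j))) : |S.normWeight j i x| ≤ 1 := by
  have h1 := S.weight_nonneg hK hh i x
  have h2 := S.weight_le_sum hK hh i x
  rw [normWeight, abs_of_nonneg (div_nonneg h1 (h1.trans h2))]
  exact div_le_one_of_le₀ h2 (h1.trans h2)

/-- Where the sum vanishes, so does each of its nonnegative terms; no positivity of the density is
needed. -/
theorem normWeight_mul_sum {j : Fin d} (hK : IsBaselineKernel (S.K j)) (hh : 0 < S.h j)
    (i : Fin n) (x : EuclideanSpace ℝ (Fin (L j))) :
    S.normWeight j i x * ∑ l, S.weight j l x = S.weight j i x := by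
  rcases eq_or_ne (∑ l, S.weight j l x) 0 with h | h
  · have h1 := S.weight_nonneg hK hh i x
    have h2 := S.weight_le_sum hK hh i x
    rw [h] at h2 ⊢
    linarith
  · rw [normWeight, div_mul_cancel₀ _ h]

theorem p0Hat_mul_pos (hobs : ∃ i, S.ξ i ∈ S.domain) : 0 < S.p0Hat * n := by
  obtain ⟨i, hi⟩ := hobs
  have hn : (0 : ℝ) < n := by exact_mod_cast i.pos
  have h1 : S.ind i = 1 := by simp [ind, hi]
  have h2 : S.ind i ≤ ∑ l, S.ind l :=
    Finset.single_le_sum (f := S.ind) (fun l _ => S.ind_nonneg l) (Finset.mem_univ i)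
  have : 0 < ∑ l, S.ind l := by linarith
  unfold p0Hat
  positivity

theorem pHat1_eq (j : Fin d) (x : EuclideanSpace ℝ (Fin (L j))) :
    S.pHat1 j x = (S.p0Hat * n)⁻¹ * ∑ i, S.weight j i x := rfl

theorem pHat2_div_pHat1 (hN : 0 < S.p0Hat * n) (j k : Fin d)
    (x : EuclideanSpace ℝ (Fin (L j))) (y : EuclideanSpace ℝ (Fin (L k))) :
    S.pHat2 j k x y / S.pHat1 j x = ∑ i, S.normWeight j i x * S.weight k i y := by
  rw [pHat1_eq, pHat2, mul_div_mul_left _ _ (inv_ne_zero hN.ne'), Finset.sum_div]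
  refine Finset.sum_congr rfl fun i _ => ?_
  rw [normWeight, weight, weight, div_mul_eq_mul_div]
  congr 1
  linear_combination -(S.kernel j x (S.ξ i j) * S.kernel k y (S.ξ i k)) * S.ind_mul_self i

theorem isProbabilityMeasure_kernelLaw {j : Fin d} (hD : IsCompact (S.D j))
    (hpos : 0 < volume (S.D j)) (hK : IsBaselineKernel (S.K j)) (hh : 0 < S.h j) (l : Fin n) :
    IsProbabilityMeasure (S.kernelLaw j l) := by
  refine ⟨?_⟩
  rw [kernelLaw, withDensity_apply _ MeasurableSet.univ, Measure.restrict_univ,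
    ← ofReal_integral_eq_lintegral_ofReal (S.integrableOn_kernel hD hK hh _)
      (ae_of_all _ fun x => S.kernel_nonneg hK hh _ _), S.setIntegral_kernel hD hpos,
    ENNReal.ofReal_one]

theorem integral_kernelLaw {j : Fin d} (hK : IsBaselineKernel (S.K j)) (hh : 0 < S.h j)
    (l : Fin n) (g : EuclideanSpace ℝ (Fin (L j)) → ℝ) :
    ∫ x, g x ∂S.kernelLaw j l = ∫ x in S.D j, S.kernel j x (S.ξ l j) * g x := by
  rw [kernelLaw, integral_withDensity_eq_integral_toReal_smul
    (S.continuous_kernel hK hh _).measurable.ennreal_ofReal (by simp)]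
  simp [ENNReal.toReal_ofReal (S.kernel_nonneg hK hh _ _)]

/-- `P̂^D` is a mixture of product measures. -/
theorem measureHat_eq_sum (hD : ∀ j, IsCompact (S.D j)) (hK : ∀ j, IsBaselineKernel (S.K j))
    (hh : ∀ j, 0 < S.h j) (hN : 0 < S.p0Hat * n) :
    S.measureHat = ∑ l, ENNReal.ofReal ((S.p0Hat * n)⁻¹ * S.ind l) •
      Measure.pi fun j => S.kernelLaw j l := by
  have hmeas : ∀ l, Measurable fun x : (j : Fin d) → EuclideanSpace ℝ (Fin (L j)) =>
      ENNReal.ofReal (∏ j, S.kernel j (x j) (S.ξ l j)) := fun l =>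
    (Finset.measurable_fun_prod _ fun j _ =>
      (S.continuous_kernel (hK j) (hh j) _).measurable.comp (measurable_pi_apply j)).ennreal_ofReal
  have hfin : ∀ j, IsFiniteMeasure (volume.restrict (S.D j)) := fun j =>
    isFiniteMeasure_restrict.2 (hD j).measure_lt_top.ne
  have hprod : ∀ l, (Measure.pi fun j => S.kernelLaw j l) =
      (volume.restrict S.domain).withDensity fun x =>
        ENNReal.ofReal (∏ j, S.kernel j (x j) (S.ξ l j)) := by
    intro l
    rw [domain, volume_pi, Measure.restrict_pi_pi]
    exact (Measure.pi_withDensity_ofReal _ (fun j x => S.kernel j x (S.ξ l j))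
      (fun j => S.integrableOn_kernel (hD j) (hK j) (hh j) _)
      fun j x => S.kernel_nonneg (hK j) (hh j) _ _).symm
  ext s hs
  have hterm : ∀ l, (ENNReal.ofReal ((S.p0Hat * n)⁻¹ * S.ind l) •
      Measure.pi fun j => S.kernelLaw j l) s = ∫⁻ x in s,
        ENNReal.ofReal ((S.p0Hat * n)⁻¹ * S.ind l) *
        ENNReal.ofReal (∏ j, S.kernel j (x j) (S.ξ l j)) ∂(volume.restrict S.domain) := by
    intro l
    rw [hprod, Measure.smul_apply, withDensity_apply _ hs, lintegral_const_mul _ (hmeas l),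
      smul_eq_mul]
  rw [measureHat, withDensity_apply _ hs, Measure.coe_finsetSum, Finset.sum_apply]
  simp only [hterm]
  rw [← lintegral_finsetSum _ fun l _ => (hmeas l).const_mul _]
  refine lintegral_congr fun x => ?_
  have h0 : ∀ l, 0 ≤ (S.p0Hat * n)⁻¹ * S.ind l := fun l =>
    mul_nonneg (inv_nonneg.2 hN.le) (S.ind_nonneg l)
  have h1 : ∀ l, 0 ≤ ∏ j, S.kernel j (x j) (S.ξ l j) := fun l =>
    Finset.prod_nonneg fun j _ => S.kernel_nonneg (hK j) (hh j) _ _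
  simp only [← ENNReal.ofReal_mul (h0 _)]
  rw [← ENNReal.ofReal_sum_of_nonneg fun l _ => mul_nonneg (h0 l) (h1 l), pHat, Finset.mul_sum]
  congr 1
  exact Finset.sum_congr rfl fun l _ => by ring

theorem isFiniteMeasure_measureHat (hD : ∀ j, IsCompact (S.D j))
    (hpos : ∀ j, 0 < volume (S.D j)) (hK : ∀ j, IsBaselineKernel (S.K j))
    (hh : ∀ j, 0 < S.h j) (hN : 0 < S.p0Hat * n) : IsFiniteMeasure S.measureHat := by
  have := fun j l => S.isProbabilityMeasure_kernelLaw (hD j) (hpos j) (hK j) (hh j) l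
  refine ⟨?_⟩
  rw [S.measureHat_eq_sum hD hK hh hN]
  simp

theorem integral_measureHat (hD : ∀ j, IsCompact (S.D j))
    (hK : ∀ j, IsBaselineKernel (S.K j))
    (hh : ∀ j, 0 < S.h j) (hN : 0 < S.p0Hat * n)
    {g : ((j : Fin d) → EuclideanSpace ℝ (Fin (L j))) → ℝ} (hg : Integrable g S.measureHat) :
    ∫ x, g x ∂S.measureHat = (S.p0Hat * n)⁻¹ * ∑ l, S.ind l *
      ∫ x, g x ∂Measure.pi fun j => S.kernelLaw j l := by
  rw [S.measureHat_eq_sum hD hK hh hN] at hg ⊢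
  rw [integrable_finsetSum_measure] at hg
  rw [integral_finsetSum_measure hg, Finset.mul_sum]
  refine Finset.sum_congr rfl fun l _ => ?_
  rw [integral_smul_measure, ENNReal.toReal_ofReal
    (mul_nonneg (inv_nonneg.2 hN.le) (S.ind_nonneg l)), smul_eq_mul, mul_assoc]

/-- A function of the `j`-th component is integrable for `P̂^D` if it is so on `D j` against the
marginal density. -/
theorem integrable_comp_eval (hD : ∀ j, IsCompact (S.D j))
    (hpos : ∀ j, 0 < volume (S.D j)) (hK : ∀ j, IsBaselineKernel (S.K j))
    (hh : ∀ j, 0 < S.h j) (hN : 0 < S.p0Hat * n) (j : Fin d)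
    {g : EuclideanSpace ℝ (Fin (L j)) → ℝ}
    (hm : AEStronglyMeasurable g (volume.restrict (S.D j)))
    (hg : IntegrableOn (fun x => g x * S.pHat1 j x) (S.D j)) :
    Integrable (fun x => g (x j)) S.measureHat := by
  have := fun j l => S.isProbabilityMeasure_kernelLaw (hD j) (hpos j) (hK j) (hh j) l
  rw [S.measureHat_eq_sum hD hK hh hN, integrable_finsetSum_measure]
  intro l _
  rcases S.ind_eq_zero_or_one l with h | h
  · simp [h]
  refine Integrable.smul_measure ?_ ENNReal.ofReal_ne_top
  have hmp := measurePreserving_eval (fun j => S.kernelLaw j l) j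
  refine (hmp.integrable_comp_of_integrable (g := g) ?_)
  rw [kernelLaw, integrable_withDensity_iff
    (S.continuous_kernel (hK j) (hh j) _).measurable.ennreal_ofReal (by simp)]
  simp only [ENNReal.toReal_ofReal (S.kernel_nonneg (hK j) (hh j) _ _)]
  -- A single kernel weight is at most the sum of all of them, which is $N\hat p^D_j$.
  refine (hg.const_mul (S.p0Hat * n)).mono
    (hm.mul (S.continuous_kernel (hK j) (hh j) _).aestronglyMeasurable)
    (ae_of_all _ fun x => ?_)
  have h1 := S.weight_le_sum (hK j) (hh j) l x
  have h2 : 0 ≤ ∑ l, S.weight j l x := (S.weight_nonneg (hK j) (hh j) l x).trans h1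
  have h3 : S.p0Hat * n * (g x * S.pHat1 j x) = g x * ∑ l, S.weight j l x := by
    rw [pHat1_eq, mul_left_comm, mul_inv_cancel_left₀ hN.ne']
  rw [h3, norm_mul, norm_mul]
  simp only [weight, h, mul_one] at h1 h2 ⊢
  rw [Real.norm_of_nonneg (S.kernel_nonneg (hK j) (hh j) _ _), Real.norm_of_nonneg h2]
  exact mul_le_mul_of_nonneg_left h1 (norm_nonneg _)

theorem memLp_normWeight (hD : ∀ j, IsCompact (S.D j))
    (hpos : ∀ j, 0 < volume (S.D j)) (hK : ∀ j, IsBaselineKernel (S.K j))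
    (hh : ∀ j, 0 < S.h j) (hN : 0 < S.p0Hat * n) (j : Fin d) (i : Fin n) :
    MemLp (fun x : (j : Fin d) → EuclideanSpace ℝ (Fin (L j)) => S.normWeight j i (x j)) 2
      S.measureHat := by
  have := S.isFiniteMeasure_measureHat hD hpos hK hh hN
  exact MemLp.of_bound ((S.measurable_normWeight (hK j) (hh j) i).comp
    (measurable_pi_apply j)).aestronglyMeasurable 1
    (ae_of_all _ fun x => S.abs_normWeight_le_one (hK j) (hh j) i _)

/-- Up to the indicator, `transfer j l i` is the conditional mean of the normalized weight given the
label `l`. -/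
theorem ind_mul_integral_kernelLaw_normWeight {j : Fin d} (hK : IsBaselineKernel (S.K j))
    (hh : 0 < S.h j) (l i : Fin n) :
    S.ind l * ∫ x, S.normWeight j i x ∂S.kernelLaw j l = S.transfer j l i := by
  rw [S.integral_kernelLaw hK hh, transfer, ← integral_const_mul]
  congr 1
  ext x
  rw [weight]
  ring

/-- Given the label `l`, distinct components are independent, so the conditional mean of the product
factorizes. -/
theorem integral_normWeight_mul_of_ne (hD : ∀ j, IsCompact (S.D j))
    (hpos : ∀ j, 0 < volume (S.D j)) (hK : ∀ j, IsBaselineKernel (S.K j))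
    (hh : ∀ j, 0 < S.h j) (hN : 0 < S.p0Hat * n) {j k : Fin d} (hkj : k ≠ j) (i i' : Fin n) :
    ∫ x, S.normWeight j i (x j) * S.normWeight k i' (x k) ∂S.measureHat =
      (S.p0Hat * n)⁻¹ * ∑ l, S.transfer j l i * S.transfer k l i' := by
  have := fun j l => S.isProbabilityMeasure_kernelLaw (hD j) (hpos j) (hK j) (hh j) l
  rw [S.integral_measureHat hD hK hh hN
    (g := fun x => S.normWeight j i (x j) * S.normWeight k i' (x k))
    ((S.memLp_normWeight hD hpos hK hh hN j i).integrable_mul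
      (S.memLp_normWeight hD hpos hK hh hN k i'))]
  congr 1
  refine Finset.sum_congr rfl fun l _ => ?_
  have hi := (ProbabilityTheory.iIndepFun_pi (μ := fun j => S.kernelLaw j l) (X := fun _ x => x)
    fun _ => aemeasurable_id).indepFun hkj.symm
  have h1 := (hi.comp (S.measurable_normWeight (hK j) (hh j) i)
    (S.measurable_normWeight (hK k) (hh k) i')).integral_fun_mul_eq_mul_integral
    (((S.measurable_normWeight (hK j) (hh j) i).comp
      (measurable_pi_apply j)).aestronglyMeasurable)
    (((S.measurable_normWeight (hK k) (hh k) i').comp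
      (measurable_pi_apply k)).aestronglyMeasurable)
  simp only [Function.comp_apply] at h1
  rw [h1, ← S.ind_mul_integral_kernelLaw_normWeight (hK j) (hh j),
    ← S.ind_mul_integral_kernelLaw_normWeight (hK k) (hh k),
    integral_comp_eval (μ := fun j => S.kernelLaw j l)
      (S.measurable_normWeight (hK j) (hh j) i).aestronglyMeasurable,
    integral_comp_eval (μ := fun j => S.kernelLaw j l)
      (S.measurable_normWeight (hK k) (hh k) i').aestronglyMeasurable]
  linear_combination -((∫ x, S.normWeight j i x ∂S.kernelLaw j l) *
    ∫ x, S.normWeight k i' x ∂S.kernelLaw k l) * S.ind_mul_self l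

/-- Summing over the mixture label turns the second normalized weight back into the weight of `l`.
Thus the index of a vector in the block plays the role of a label, which matches the diagonal Gram
blocks to the recursion. -/
theorem integral_normWeight_mul_self (hD : ∀ j, IsCompact (S.D j))
    (hpos : ∀ j, 0 < volume (S.D j)) (hK : ∀ j, IsBaselineKernel (S.K j))
    (hh : ∀ j, 0 < S.h j) (hN : 0 < S.p0Hat * n) (j : Fin d) (i l : Fin n) :
    ∫ x, S.normWeight j i (x j) * S.normWeight j l (x j) ∂S.measureHat =
      (S.p0Hat * n)⁻¹ * S.transfer j l i := by
  have := fun j l => S.isProbabilityMeasure_kernelLaw (hD j) (hpos j) (hK j) (hh j) l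
  have hm : Measurable fun x => S.normWeight j i x * S.normWeight j l x :=
    (S.measurable_normWeight (hK j) (hh j) i).mul (S.measurable_normWeight (hK j) (hh j) l)
  have hb : ∀ x, ‖S.normWeight j i x * S.normWeight j l x‖ ≤ 1 := fun x => by
    rw [norm_mul]
    exact mul_le_one₀ (S.abs_normWeight_le_one (hK j) (hh j) i x) (norm_nonneg _)
      (S.abs_normWeight_le_one (hK j) (hh j) l x)
  rw [S.integral_measureHat hD hK hh hN
    (g := fun x => S.normWeight j i (x j) * S.normWeight j l (x j))
    ((S.memLp_normWeight hD hpos hK hh hN j i).integrable_mul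
      (S.memLp_normWeight hD hpos hK hh hN j l)), transfer]
  congr 1
  have h1 : ∀ l', S.ind l' * ∫ x, S.normWeight j i (x j) * S.normWeight j l (x j)
      ∂Measure.pi (fun j => S.kernelLaw j l') =
      ∫ x in S.D j, S.weight j l' x * (S.normWeight j i x * S.normWeight j l x) := by
    intro l'
    rw [integral_comp_eval (μ := fun j => S.kernelLaw j l') (i := j)
      (f := fun x => S.normWeight j i x * S.normWeight j l x) hm.aestronglyMeasurable,
      S.integral_kernelLaw (hK j) (hh j), ← integral_const_mul]
    congr 1
    ext x
    rw [weight]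
    ring
  simp only [h1]
  rw [← integral_finsetSum]
  · congr 1
    ext x
    rw [← Finset.sum_mul, ← S.normWeight_mul_sum (hK j) (hh j) l]
    ring
  · intro l' _
    exact ((S.continuous_weight (hK j) (hh j) l').continuousOn.integrableOn_compact
      (hD j)).mul_bdd (c := 1) hm.aestronglyMeasurable (ae_of_all _ hb)

theorem integrableOn_weight_mul_normWeight {j : Fin d} (hD : IsCompact (S.D j))
    (hK : IsBaselineKernel (S.K j)) (hh : 0 < S.h j) (l i : Fin n) :
    IntegrableOn (fun x => S.weight j l x * S.normWeight j i x) (S.D j) :=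
  ((S.continuous_weight hK hh l).continuousOn.integrableOn_compact hD).mul_bdd (c := 1)
    (S.measurable_normWeight hK hh i).aestronglyMeasurable
    (ae_of_all _ fun x => S.abs_normWeight_le_one hK hh i x)

theorem ae_mem_domain (hD : ∀ j, IsCompact (S.D j)) : ∀ᵐ x ∂S.measureHat, x ∈ S.domain :=
  (withDensity_absolutelyContinuous _ _).ae_le
    (ae_restrict_mem (MeasurableSet.univ_pi fun j => (hD j).measurableSet))

end Setup
end
end SBF

/-! ### Error recursion of the sweeps and its geometric decay -/

namespace SBF
noncomputable section
namespace Setup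

variable {d n : ℕ} {L : Fin d → ℕ} {H : Type*} (S : Setup d n L H)
variable [NormedAddCommGroup H] [InnerProductSpace ℝ H]

theorem integrableOn_weight_smul {j : Fin d} (hD : IsCompact (S.D j))
    (hK : IsBaselineKernel (S.K j)) (hh : 0 < S.h j) (hN : 0 < S.p0Hat * n) (i : Fin n)
    {g : EuclideanSpace ℝ (Fin (L j)) → H}
    (hm : AEStronglyMeasurable g (volume.restrict (S.D j)))
    (hg : IntegrableOn (fun x => ‖g x‖ ^ 2 * S.pHat1 j x) (S.D j)) :
    IntegrableOn (fun x => S.weight j i x • g x) (S.D j) := by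
  have hp : IntegrableOn (S.pHat1 j) (S.D j) := by
    refine Continuous.continuousOn ?_ |>.integrableOn_compact hD
    exact continuous_const.mul (continuous_finsetSum _ fun l _ => S.continuous_weight hK hh l)
  refine ((hp.add hg).const_mul (S.p0Hat * n)).mono
    ((S.continuous_weight hK hh i).aestronglyMeasurable.smul hm) (ae_of_all _ fun x => ?_)
  have h1 := S.weight_le_sum hK hh i x
  have h0 := S.weight_nonneg hK hh i x
  have h3 : S.p0Hat * n * (S.pHat1 j x + ‖g x‖ ^ 2 * S.pHat1 j x) =
      (∑ l, S.weight j l x) * (1 + ‖g x‖ ^ 2) := by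
    have : S.p0Hat * n * S.pHat1 j x = ∑ l, S.weight j l x := by
      rw [pHat1_eq, mul_inv_cancel_left₀ hN.ne']
    rw [← this]
    ring
  simp only [Pi.add_apply]
  rw [h3, norm_smul, Real.norm_of_nonneg h0,
    Real.norm_of_nonneg (mul_nonneg (h0.trans h1) (by positivity))]
  -- Square integrability against the marginal density suffices, as that density is itself
  -- integrable on `D j`.
  have h4 : ‖g x‖ ≤ 1 + ‖g x‖ ^ 2 := by nlinarith [sq_nonneg (‖g x‖ - 1)]
  exact mul_le_mul h1 h4 (norm_nonneg _) (h0.trans h1)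

theorem condInt_eq (hN : 0 < S.p0Hat * n) (j k : Fin d) {g : EuclideanSpace ℝ (Fin (L k)) → H}
    (hg : ∀ i, IntegrableOn (fun y => S.weight k i y • g y) (S.D k))
    (x : EuclideanSpace ℝ (Fin (L j))) :
    S.condInt j k g x = ∑ i, S.normWeight j i x • ∫ y in S.D k, S.weight k i y • g y := by
  have h1 : ∀ y, (S.pHat2 j k x y / S.pHat1 j x) • g y =
      ∑ i, S.normWeight j i x • S.weight k i y • g y := fun y => by
    rw [S.pHat2_div_pHat1 hN, Finset.sum_smul]
    simp only [mul_smul]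
  rw [condInt]
  simp only [h1]
  rw [integral_finsetSum _ fun i _ => Integrable.fun_smul (S.normWeight j i x) (hg i)]
  simp only [integral_smul]

theorem condInt_sub (hN : 0 < S.p0Hat * n) (j k : Fin d)
    {g g' : EuclideanSpace ℝ (Fin (L k)) → H}
    (hg : ∀ i, IntegrableOn (fun y => S.weight k i y • g y) (S.D k))
    (hg' : ∀ i, IntegrableOn (fun y => S.weight k i y • g' y) (S.D k))
    (x : EuclideanSpace ℝ (Fin (L j))) :
    S.condInt j k g x - S.condInt j k g' x =
      ∑ i, S.normWeight j i x • ∫ y in S.D k, S.weight k i y • (g y - g' y) := by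
  rw [S.condInt_eq hN j k hg, S.condInt_eq hN j k hg', ← Finset.sum_sub_distrib]
  refine Finset.sum_congr rfl fun i _ => ?_
  simp only [smul_sub]
  rw [integral_sub (hg i) (hg' i), smul_sub]

/-- The coefficients, with respect to the normalized weights, of the difference between one sweep
started from `g` and a solution `f` of the estimating equations. -/
def sweepCoeff (f g : (j : Fin d) → EuclideanSpace ℝ (Fin (L j)) → H) (j : Fin d) (i : Fin n) : H :=
  -∑ k, if k < j then ∫ y in S.D k, S.weight k i y • (S.sweep g k y - f k y)
    else if j < k then ∫ y in S.D k, S.weight k i y • (g k y - f k y) else 0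

theorem setIntegral_weight_smul_sum [CompleteSpace H] {j : Fin d} (hD : IsCompact (S.D j))
    (hK : IsBaselineKernel (S.K j)) (hh : 0 < S.h j) (l : Fin n)
    {g : EuclideanSpace ℝ (Fin (L j)) → H} {w : Fin n → H}
    (hg : ∀ x ∈ S.D j, g x = ∑ i, S.normWeight j i x • w i) :
    IntegrableOn (fun x => S.weight j l x • g x) (S.D j) ∧
      ∫ x in S.D j, S.weight j l x • g x = ∑ i, S.transfer j l i • w i := by
  have h1 : ∀ x ∈ S.D j, S.weight j l x • g x =
      ∑ i, (S.weight j l x * S.normWeight j i x) • w i := fun x hx => by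
    rw [hg x hx, Finset.smul_sum]
    simp only [mul_smul]
  have hint : ∀ i, IntegrableOn (fun x => (S.weight j l x * S.normWeight j i x) • w i) (S.D j) :=
    fun i => (S.integrableOn_weight_mul_normWeight hD hK hh l i).smul_const (w i)
  constructor
  · refine IntegrableOn.congr_fun ?_ (fun x hx => (h1 x hx).symm) hD.measurableSet
    exact integrable_finsetSum _ fun i _ => hint i
  · rw [setIntegral_congr_fun hD.measurableSet h1, integral_finsetSum _ fun i _ => hint i]
    simp only [integral_smul_const]
    rfl

theorem sweep_eq (g : (j : Fin d) → EuclideanSpace ℝ (Fin (L j)) → H) (j : Fin d)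
    (x : EuclideanSpace ℝ (Fin (L j))) :
    S.sweep g j x = S.mHat j x - S.f0Hat -
      (∑ k ∈ Finset.univ.filter (fun k => k < j), S.condInt j k (S.sweep g k) x) -
      ∑ k ∈ Finset.univ.filter (fun k => j < k), S.condInt j k (g k) x :=
  S.iter_succ g 0 j x

/-- Both claims are proved together by induction on `j`: expanding the conditional integrals of the
components already updated requires their weighted integrability. -/
theorem sweep_sub [CompleteSpace H] (hD : ∀ j, IsCompact (S.D j))
    (hK : ∀ j, IsBaselineKernel (S.K j)) (hh : ∀ j, 0 < S.h j) (hN : 0 < S.p0Hat * n)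
    {f g : (j : Fin d) → EuclideanSpace ℝ (Fin (L j)) → H}
    (hf : ∀ j, ∀ x ∈ S.D j, f j x = S.mHat j x - S.f0Hat -
      ∑ k ∈ Finset.univ.filter (fun k => k ≠ j), S.condInt j k (f k) x)
    (hfi : ∀ k i, IntegrableOn (fun y => S.weight k i y • f k y) (S.D k))
    (hgi : ∀ k i, IntegrableOn (fun y => S.weight k i y • g k y) (S.D k)) (j : Fin d) :
    (∀ x ∈ S.D j, S.sweep g j x - f j x = ∑ i, S.normWeight j i x • S.sweepCoeff f g j i) ∧
      ∀ i, IntegrableOn (fun y => S.weight j i y • S.sweep g j y) (S.D j) := by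
  induction j using WellFoundedLT.induction with
  | ind j ih =>
  have key : ∀ x ∈ S.D j,
      S.sweep g j x - f j x = ∑ i, S.normWeight j i x • S.sweepCoeff f g j i := by
    intro x hx
    have h1 : S.sweep g j x - f j x = -∑ k, if k < j then
        S.condInt j k (S.sweep g k) x - S.condInt j k (f k) x else if j < k then
        S.condInt j k (g k) x - S.condInt j k (f k) x else 0 := by
      rw [sweep_eq, hf j x hx]
      simp only [Finset.sum_filter]
      have h2 : ∀ k, (if k < j then
        S.condInt j k (S.sweep g k) x - S.condInt j k (f k) x else if j < k then
        S.condInt j k (g k) x - S.condInt j k (f k) x else 0) =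
        (if k < j then S.condInt j k (S.sweep g k) x else 0) +
        (if j < k then S.condInt j k (g k) x else 0) -
        (if k ≠ j then S.condInt j k (f k) x else 0) := by
        intro k
        rcases lt_trichotomy k j with h | h | h
        · simp [h, h.ne, h.not_gt]
        · simp [h]
        · simp [h, h.ne', h.not_gt]
      simp only [h2, Finset.sum_sub_distrib, Finset.sum_add_distrib]
      abel
    rw [h1]
    simp only [sweepCoeff, smul_neg, Finset.smul_sum, Finset.sum_neg_distrib]
    rw [Finset.sum_comm]
    congr 1
    refine Finset.sum_congr rfl fun k _ => ?_
    split_ifs with h2 h3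
    · exact S.condInt_sub hN j k (ih k h2).2 (hfi k) x
    · exact S.condInt_sub hN j k (hgi k) (hfi k) x
    · simp
  refine ⟨key, fun i => ?_⟩
  have h1 := (S.setIntegral_weight_smul_sum (hD j) (hK j) (hh j) i key).1
  refine (h1.add (hfi j i)).congr_fun (fun x _ => ?_) (hD j).measurableSet
  simp [smul_sub]

/-- The coefficients of the errors obey a Gauss--Seidel recursion. -/
theorem sweepCoeff_sweep [CompleteSpace H] (hD : ∀ j, IsCompact (S.D j))
    (hK : ∀ j, IsBaselineKernel (S.K j)) (hh : ∀ j, 0 < S.h j)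
    {f g : (j : Fin d) → EuclideanSpace ℝ (Fin (L j)) → H}
    (h : ∀ j, ∀ x ∈ S.D j,
      S.sweep g j x - f j x = ∑ i, S.normWeight j i x • S.sweepCoeff f g j i)
    (h' : ∀ j, ∀ x ∈ S.D j, S.sweep (S.sweep g) j x - f j x =
      ∑ i, S.normWeight j i x • S.sweepCoeff f (S.sweep g) j i) (j : Fin d) (l : Fin n) :
    S.sweepCoeff f (S.sweep g) j l = -∑ k, ∑ i, S.transfer k l i •
      (if k < j then S.sweepCoeff f (S.sweep g) k i
        else if j < k then S.sweepCoeff f g k i else 0) := by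
  conv_lhs => rw [sweepCoeff]
  congr 1
  refine Finset.sum_congr rfl fun k _ => ?_
  split_ifs with h1 h2
  · exact (S.setIntegral_weight_smul_sum (hD k) (hK k) (hh k) l (h' k)).2
  · exact (S.setIntegral_weight_smul_sum (hD k) (hK k) (hh k) l (h k)).2
  · simp

theorem integrable_norm_total_sub_sq (hD : ∀ j, IsCompact (S.D j))
    (hpos : ∀ j, 0 < volume (S.D j)) (hK : ∀ j, IsBaselineKernel (S.K j))
    (hh : ∀ j, 0 < S.h j) (hN : 0 < S.p0Hat * n)
    {f g : (j : Fin d) → EuclideanSpace ℝ (Fin (L j)) → H}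
    (hf : S.Constraints f) (hg : S.Constraints g) :
    Integrable (fun x => ‖S.total g x - S.total f x‖ ^ 2) S.measureHat := by
  have hcomp : ∀ {g : (j : Fin d) → EuclideanSpace ℝ (Fin (L j)) → H}, S.Constraints g →
      MemLp (fun x : (j : Fin d) → EuclideanSpace ℝ (Fin (L j)) => ∑ j, g j (x j)) 2
        S.measureHat := by
    intro g hg
    refine memLp_finsetSum _ fun j _ => ?_
    have hqmp : Measure.QuasiMeasurePreserving (Function.eval j) S.measureHat
        (volume.restrict (S.D j)) := by
      have hfin : ∀ j, IsFiniteMeasure (volume.restrict (S.D j)) := fun j =>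
        isFiniteMeasure_restrict.2 (hD j).measure_lt_top.ne
      have h1 : Measure.QuasiMeasurePreserving (Function.eval j) (volume.restrict S.domain)
          (volume.restrict (S.D j)) := by
        rw [domain, volume_pi, Measure.restrict_pi_pi]
        exact Measure.quasiMeasurePreserving_eval (fun j => volume.restrict (S.D j)) j
      exact h1.mono_left (withDensity_absolutelyContinuous _ _)
    have h2 := S.integrable_comp_eval hD hpos hK hh hN j (g := fun x => ‖g j x‖ ^ 2)
      ((hg j).1.norm.pow 2) (hg j).2.1
    have h3 : AEStronglyMeasurable (fun x : (j : Fin d) → EuclideanSpace ℝ (Fin (L j)) =>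
      g j (x j)) S.measureHat := (hg j).1.comp_quasiMeasurePreserving hqmp
    exact (memLp_two_iff_integrable_sq_norm h3).2 h2
  have h2 : MemLp (fun x => S.total g x - S.total f x) 2 S.measureHat := by
    simp only [total, add_sub_add_left_eq_sub]
    exact (hcomp hg).sub (hcomp hf)
  exact (memLp_two_iff_integrable_sq_norm h2.1).1 h2

/-- The exceptional null set serves all `r` at once. The exponent lags by one because the starting
tuple need not differ from `f` by a combination of normalized weights; only its first sweep does. -/
theorem exists_ae_norm_total_sub_le [CompleteSpace H] (hD : ∀ j, IsCompact (S.D j))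
    (hpos : ∀ j, 0 < volume (S.D j)) (hK : ∀ j, IsBaselineKernel (S.K j))
    (hh : ∀ j, 0 < S.h j) (hN : 0 < S.p0Hat * n)
    {f f₀ : (j : Fin d) → EuclideanSpace ℝ (Fin (L j)) → H} (hf : S.IsEstimator f)
    (hf₀ : S.Constraints f₀) :
    (∀ r, AEStronglyMeasurable (fun x => S.total (S.iter f₀ (r + 1)) x - S.total f x)
      S.measureHat) ∧
    ∃ C, 0 ≤ C ∧ ∃ ρ ∈ Set.Ioo (0 : ℝ) 1, ∀ᵐ x ∂S.measureHat, ∀ r,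
      ‖S.total (S.iter f₀ (r + 1)) x - S.total f x‖ ≤ C * ρ ^ r := by
  have hfi := fun k i =>
    S.integrableOn_weight_smul (hD k) (hK k) (hh k) hN i (hf.2 k).1 (hf.2 k).2.1
  have hint : ∀ r k i,
      IntegrableOn (fun y => S.weight k i y • S.iter f₀ r k y) (S.D k) := by
    intro r
    induction r with
    | zero => exact fun k i =>
        S.integrableOn_weight_smul (hD k) (hK k) (hh k) hN i (hf₀ k).1 (hf₀ k).2.1
    | succ r ih => exact fun k => (S.sweep_sub hD hK hh hN hf.1 hfi ih k).2
  have hsub := fun r j => (S.sweep_sub hD hK hh hN hf.1 hfi (hint r) j).1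
  let w : ℕ → Fin d → Fin n → H := fun r => S.sweepCoeff f (S.iter f₀ r)
  have hw : ∀ r j l, w (r + 1) j l = -∑ k, ∑ i, S.transfer k l i •
      (if k < j then w (r + 1) k i else if j < k then w r k i else 0) := fun r =>
    S.sweepCoeff_sweep hD hK hh (hsub r) (hsub (r + 1))
  have htot : ∀ x ∈ S.domain, ∀ r, S.total (S.iter f₀ (r + 1)) x - S.total f x =
      ∑ j, ∑ i, S.normWeight j i (x j) • w r j i := by
    intro x hx r
    rw [total, total, add_sub_add_left_eq_sub, ← Finset.sum_sub_distrib]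
    exact Finset.sum_congr rfl fun j _ => hsub r j (x j) (hx j (Set.mem_univ j))
  constructor
  · intro r
    have hm : AEStronglyMeasurable (fun x => ∑ j, ∑ i, S.normWeight j i (x j) • w r j i)
        S.measureHat := by
      refine Finset.aestronglyMeasurable_fun_sum _ fun j _ =>
        Finset.aestronglyMeasurable_fun_sum _ fun i _ => ?_
      exact (S.memLp_normWeight hD hpos hK hh hN j i).1.smul_const _
    refine hm.congr ?_
    filter_upwards [S.ae_mem_domain hD] with x hx
    exact (htot x hx r).symm
  have hmem := S.memLp_normWeight hD hpos hK hh hN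
  let e : Fin d → Fin n → Lp ℝ 2 S.measureHat := fun j i => (hmem j i).toLp _
  have hinner : ∀ j k i i', inner ℝ (e j i) (e k i') =
      ∫ x, S.normWeight j i (x j) * S.normWeight k i' (x k) ∂S.measureHat := by
    intro j k i i'
    rw [L2.inner_def]
    refine integral_congr_ae ?_
    filter_upwards [(hmem j i).coeFn_toLp, (hmem k i').coeFn_toLp] with x h1 h2
    rw [h1, h2]
    simp [mul_comm]
  obtain ⟨ρ, hρ, hcon⟩ := exists_gauss_seidel_contraction e S.transfer (S.p0Hat * n)⁻¹
    (fun j i l => (hinner _ _ _ _).trans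
      (S.integral_normWeight_mul_self hD hpos hK hh hN j i l))
    (fun j k hkj i i' => (hinner _ _ _ _).trans
      (S.integral_normWeight_mul_of_ne hD hpos hK hh hN hkj i i'))
  obtain ⟨C, hC, hae⟩ := exists_ae_abs_sum_le_norm_toLp (μ := S.measureHat)
    (fun (p : Fin d × Fin n) x => S.normWeight p.1 p.2 (x p.1)) (fun p => hmem p.1 p.2)
    (fun p x => S.abs_normWeight_le_one (hK p.1) (hh p.1) p.2 (x p.1))
  refine ⟨C * ∑ j, ∑ i, ‖w 0 j i‖ * ‖e j i‖, by positivity, ρ, hρ, ?_⟩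
  filter_upwards [hae, S.ae_mem_domain hD] with x hx hxD r
  -- The scalar contraction applies to the coefficients paired with one fixed vector. Choosing the
  -- error itself at `x` recovers `‖v‖ ^ 2`. This is legitimate because the pointwise bound holds
  -- for all coefficients off one null set, although `v` depends on `x` and `r`.
  set v := S.total (S.iter f₀ (r + 1)) x - S.total f x with hv
  have hpow : ∀ s, ‖∑ j, ∑ i, inner ℝ v (w s j i) • e j i‖ ≤
      ρ ^ s * ‖∑ j, ∑ i, inner ℝ v (w 0 j i) • e j i‖ := by
    intro s
    induction s with
    | zero => simp
    | succ s ih =>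
      have h1 := hcon (fun j i => inner ℝ v (w s j i)) (fun j i => inner ℝ v (w (s + 1) j i)) (by
        intro j l
        rw [hw s j l, inner_neg_right, inner_sum]
        congr 1
        refine Finset.sum_congr rfl fun k _ => ?_
        rw [inner_sum]
        refine Finset.sum_congr rfl fun i _ => ?_
        rw [inner_smul_right]
        split_ifs <;> simp)
      calc _ ≤ ρ * ‖∑ j, ∑ i, inner ℝ v (w s j i) • e j i‖ := h1
        _ ≤ ρ * (ρ ^ s * ‖∑ j, ∑ i, inner ℝ v (w 0 j i) • e j i‖) :=
          mul_le_mul_of_nonneg_left ih hρ.1.le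
        _ = _ := by ring
  have h0 : ‖∑ j, ∑ i, inner ℝ v (w 0 j i) • e j i‖ ≤ ‖v‖ * ∑ j, ∑ i, ‖w 0 j i‖ * ‖e j i‖ := by
    simp only [Finset.mul_sum]
    refine (norm_sum_le _ _).trans (Finset.sum_le_sum fun j _ => ?_)
    refine (norm_sum_le _ _).trans (Finset.sum_le_sum fun i _ => ?_)
    rw [norm_smul, ← mul_assoc]
    exact mul_le_mul_of_nonneg_right (norm_inner_le_norm _ _) (norm_nonneg _)
  have h1 : ‖v‖ * ‖v‖ ≤ C * ‖∑ j, ∑ i, inner ℝ v (w r j i) • e j i‖ := by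
    have h2 := hx fun p => inner ℝ v (w r p.1 p.2)
    simp only [Fintype.sum_prod_type] at h2
    refine le_trans (le_of_eq ?_) h2
    have h3 : ∑ j, ∑ i, inner ℝ v (w r j i) * S.normWeight j i (x j) = ‖v‖ * ‖v‖ := by
      rw [← real_inner_self_eq_norm_mul_norm]
      refine Eq.trans ?_ (congrArg (inner ℝ v) (htot x hxD r)).symm
      simp only [inner_sum, inner_smul_right, mul_comm]
    rw [h3, abs_of_nonneg (mul_self_nonneg _)]
  -- Both bounds carry a factor `‖v‖`, which cancels unless it is zero.
  rcases eq_or_ne ‖v‖ 0 with hz | hz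
  · rw [hz]
    have := hρ.1
    positivity
  · have hvpos : 0 < ‖v‖ := lt_of_le_of_ne (norm_nonneg _) hz.symm
    refine le_of_mul_le_mul_left (h1.trans ?_) hvpos
    calc _ ≤ C * (ρ ^ r * (‖v‖ * ∑ j, ∑ i, ‖w 0 j i‖ * ‖e j i‖)) := by
          refine mul_le_mul_of_nonneg_left ((hpow r).trans ?_) hC
          exact mul_le_mul_of_nonneg_left h0 (pow_nonneg hρ.1.le _)
      _ = _ := by ring

end Setup
end
end SBF

/-! ### The three modes of convergence -/

theorem proposition5 {d n : ℕ} {L : Fin d → ℕ} {H : Type*}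
    [NormedAddCommGroup H] [InnerProductSpace ℝ H] [CompleteSpace H]
    [TopologicalSpace.SeparableSpace H]
    (S : SBF.Setup d n L H)
    (hD : ∀ j, IsCompact (S.D j)) (hDpos : ∀ j, 0 < volume (S.D j))
    (hK : ∀ j, SBF.IsBaselineKernel (S.K j)) (hh : ∀ j, 0 < S.h j)
    (hobs : ∃ i, S.ξ i ∈ S.domain)
    (hA : S.ConditionA)
    (f : (j : Fin d) → EuclideanSpace ℝ (Fin (L j)) → H) (hf : S.IsEstimator f)
    (f₀ : (j : Fin d) → EuclideanSpace ℝ (Fin (L j)) → H) (hf₀ : S.Constraints f₀) :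
    (∃ c > (0 : ℝ), ∃ ϱ ∈ Set.Ioo (0 : ℝ) 1, ∀ r : ℕ,
      Integrable (fun x => ‖S.total (S.iter f₀ r) x - S.total f x‖ ^ 2) S.measureHat ∧
      ∫ x, ‖S.total (S.iter f₀ r) x - S.total f x‖ ^ 2 ∂S.measureHat ≤ c * ϱ ^ r) ∧
    (∀ᵐ x ∂S.measureHat,
      Tendsto (fun r : ℕ => ‖S.total (S.iter f₀ r) x - S.total f x‖) atTop (𝓝 0)) ∧
    (∀ ε > (0 : ℝ), ∃ A ⊆ S.domain, MeasurableSet A ∧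
      S.measureHat (S.domain \ A) < ENNReal.ofReal ε ∧
      Tendsto (fun r : ℕ => ⨆ x ∈ A, ‖S.total (S.iter f₀ r) x - S.total f x‖ₑ)
        atTop (𝓝 0)) := by
  have hN := S.p0Hat_mul_pos hobs
  have hfin := S.isFiniteMeasure_measureHat hD hDpos hK hh hN
  obtain ⟨hmeas, C, hC, ρ, hρ, hae⟩ := S.exists_ae_norm_total_sub_le hD hDpos hK hh hN hf hf₀
  have hlim : Tendsto (fun r : ℕ => C * ρ ^ r) atTop (𝓝 0) := by
    simpa using (tendsto_pow_atTop_nhds_zero_of_lt_one hρ.1.le hρ.2).const_mul C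
  refine ⟨?_, ?_, ?_⟩
  · have h0 := S.integrable_norm_total_sub_sq hD hDpos hK hh hN hf.2 hf₀
    have hbound : ∀ r, ∀ᵐ x ∂S.measureHat,
        ‖S.total (S.iter f₀ (r + 1)) x - S.total f x‖ ^ 2 ≤ C ^ 2 * (ρ ^ 2) ^ r := by
      intro r
      filter_upwards [hae] with x hx
      calc _ ≤ (C * ρ ^ r) ^ 2 := pow_le_pow_left₀ (norm_nonneg _) (hx r) 2
        _ = _ := by ring
    have hint : ∀ r, Integrable
        (fun x => ‖S.total (S.iter f₀ (r + 1)) x - S.total f x‖ ^ 2) S.measureHat := fun r =>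
      Integrable.of_bound ((hmeas r).norm.pow 2) (C ^ 2 * (ρ ^ 2) ^ r) (by
        filter_upwards [hbound r] with x hx
        rwa [Real.norm_of_nonneg (by positivity)])
    have hρ2 : 0 < ρ ^ 2 := pow_pos hρ.1 2
    set I₀ := ∫ x, ‖S.total f₀ x - S.total f x‖ ^ 2 ∂S.measureHat with hI₀
    have hI : 0 ≤ I₀ := integral_nonneg fun x => by positivity
    set B := S.measureHat.real Set.univ * C ^ 2 / ρ ^ 2 with hB
    have hB0 : 0 ≤ B := by positivity
    -- `I₀` covers `r = 0`, `B` absorbs the index shift through its division by `ρ ^ 2`, and `1`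
    -- ensures positivity.
    refine ⟨I₀ + B + 1, by positivity, ρ ^ 2, ⟨hρ2, pow_lt_one₀ hρ.1.le hρ.2 two_ne_zero⟩, ?_⟩
    rintro (_ | r)
    · refine ⟨h0, ?_⟩
      rw [pow_zero, mul_one]
      change I₀ ≤ _
      linarith
    · refine ⟨hint r, ?_⟩
      calc _ ≤ ∫ _x, C ^ 2 * (ρ ^ 2) ^ r ∂S.measureHat :=
            integral_mono_ae (hint r) (integrable_const _) (hbound r)
        _ = B * (ρ ^ 2) ^ (r + 1) := by
            rw [integral_const, smul_eq_mul, hB, pow_succ, div_mul_eq_mul_div, eq_div_iff hρ2.ne']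
            ring
        _ ≤ _ := mul_le_mul_of_nonneg_right (by linarith) (by positivity)
  · filter_upwards [hae] with x hx
    rw [← tendsto_add_atTop_iff_nat 1]
    exact squeeze_zero (fun _ => norm_nonneg _) hx hlim
  · intro ε hε
    obtain ⟨T, hT, hTm, hT0⟩ := exists_measurable_superset_of_null (ae_iff.1 hae)
    -- Convergence is uniform off the null set `T`, so the same set works for every `ε`.
    refine ⟨S.domain \ T, Set.sdiff_subset,
      (MeasurableSet.univ_pi fun j => (hD j).measurableSet).diff hTm, ?_, ?_⟩
    · rw [Set.sdiff_sdiff_right_self]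
      exact (measure_mono_null Set.inter_subset_right hT0).trans_lt (ENNReal.ofReal_pos.2 hε)
    · rw [← tendsto_add_atTop_iff_nat 1]
      have hlim' : Tendsto (fun r : ℕ => ENNReal.ofReal (C * ρ ^ r)) atTop (𝓝 0) := by
        simpa using ENNReal.tendsto_ofReal hlim
      refine tendsto_of_tendsto_of_tendsto_of_le_of_le tendsto_const_nhds hlim'
        (fun _ => zero_le) fun r => iSup₂_le fun x hx => ?_
      rw [← ofReal_norm]
      refine ENNReal.ofReal_le_ofReal ?_
      by_contra hlt
      exact hx.2 (hT fun h => hlt (h r))
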